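/- Generalized $(h,k)$-paging with file bundles. There are $N$ pages. A query is a bundle of $l$ pages (repetitions allowed). A cache of size $s$ holds exactly $s$ pages; if all pages of the arriving query are in the cache, the cost is $0$ and the cache does not change; otherwise the cost is $1$ (a cache miss), the requested pages are inserted, and other pages are evicted so that the size stays $s$, no other page being inserted. An online algorithm chooses the evictions knowing only the queries that have arrived so far; a randomized online algorithm is a random deterministic online algorithm. For a finite query sequence $\sigma$, $\mathbb{E}[\mathrm{ALG}(\sigma)]$ is the expected number of cache misses of ALG, with cache size $k$, and $\mathrm{OPT}(\sigma)$ is the minimum number of cache misses of an offline algorithm (which knows all of $\sigma$) with cache size $h$. Theorem. Let $l\ge 1$ and $2l\le h\le k$, and suppose that $\frac{k}{k-h}\ge e$ (which is regarded as true if $h=k$). Then, if $N$ is sufficiently large in terms of $h,k,l$, for every randomized online algorithm ALG with cache size $k$ and every initial content of the offline cache of size $h$ there are query sequences $\sigma$, with $\mathrm{OPT}(\sigma)>0$ arbitrarily large and with all queries consisting of $l$ distinct pages, such that $$\frac{\mathbb{E}[\mathrm{ALG}(\sigma)]}{\mathrm{OPT}(\sigma)}\;\ge\; l\ln\frac{k+1}{k-h+l+1}-l\ln\ln\frac{k+1}{k-h+l+1}-2l+1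 .$$ -/

import Mathlib

open MeasureTheory

/-- A query in a system with `N` pages: a bundle of `l` requested pages, in which a page may be
requested more than once; so the requested pages form a nonempty set of at most `l` pages. -/
def Query (N l : ℕ) : Type :=
  {Q : Finset (Fin N) // Q.Nonempty ∧ Q.card ≤ l}

/-- The set of pages that a query requests. -/
def Query.pages {N l : ℕ} (Q : Query N l) : Finset (Fin N) := Q.1

/-- The cost of answering the query `Q` with cache content `C`: it is `1` if some requested page is
missing from the cache (a cache miss), and `0` otherwise (a hit). -/
def missCost {N l : ℕ} (C : Finset (Fin N)) (Q : Query N l) : ℕ :=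
  if Q.pages ⊆ C then 0 else 1

/-- `C'` is an admissible cache content after the query `Q` has arrived at cache content `C`. After a
hit the cache does not change. After a miss the requested pages are inserted and as many pages
as necessary are evicted, so that the size of the cache is unchanged; no other page enters. -/
def CacheUpdate {N l : ℕ} (Q : Query N l) (C C' : Finset (Fin N)) : Prop :=
  (Q.pages ⊆ C → C' = C) ∧
  (¬ Q.pages ⊆ C → Q.pages ⊆ C' ∧ C' ⊆ C ∪ Q.pages ∧ C'.card = C.card)

/-- The number of cache misses on the query sequence `σ` when `C t` is the cache content at the
arrival of the query with index `t`. -/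
def missCount {N l : ℕ} (C : ℕ → Finset (Fin N)) (σ : List (Query N l)) : ℕ :=
  ∑ t : Fin σ.length, missCost (C t) (σ.get t)

/-- A deterministic online caching algorithm with cache size `k`: the content of its cache is a
function of the finite sequence of queries that have arrived so far. -/
structure OnlineAlgorithm (N k l : ℕ) where
  /-- The cache content after a given sequence of queries. -/
  cache : List (Query N l) → Finset (Fin N)
  card_init : (cache []).card = k
  update : ∀ (σ : List (Query N l)) (Q : Query N l), CacheUpdate Q (cache σ) (cache (σ ++ [Q]))

/-- The number of cache misses of a deterministic online algorithm on a query sequence. -/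
def OnlineAlgorithm.cost {N k l : ℕ} (A : OnlineAlgorithm N k l) (σ : List (Query N l)) : ℕ :=
  missCount (fun t => A.cache (σ.take t)) σ

/-- A randomized online caching algorithm with cache size `k` and random source `Ω`: a random
deterministic online algorithm, such that the cache content after each query sequence is a random
variable. -/
structure RandomizedOnlineAlgorithm (N k l : ℕ) (Ω : Type*) [MeasurableSpace Ω] where
  /-- The deterministic algorithm that is run when the outcome of the random source is `ω`. -/
  alg : Ω → OnlineAlgorithm N k l
  measurable_cache : ∀ (σ : List (Query N l)) (C : Finset (Fin N)),
    MeasurableSet {ω | (alg ω).cache σ = C}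

/-- The expected number of cache misses of a randomized online algorithm on a query sequence. -/
noncomputable def RandomizedOnlineAlgorithm.expectedCost {N k l : ℕ} {Ω : Type*}
    [MeasurableSpace Ω] (A : RandomizedOnlineAlgorithm N k l Ω) (μ : Measure Ω)
    (σ : List (Query N l)) : ℝ :=
  ∫ ω, ((A.alg ω).cost σ : ℝ) ∂μ

/-- `C` is a sequence of cache contents that an offline algorithm with initial cache content `B` can
follow on the query sequence `σ`. -/
def IsOfflineSchedule {N l : ℕ} (B : Finset (Fin N)) (σ : List (Query N l))
    (C : ℕ → Finset (Fin N)) : Prop :=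
  C 0 = B ∧ ∀ t : Fin σ.length, CacheUpdate (σ.get t) (C t) (C (t + 1))

/-- The least number of cache misses of an offline algorithm on the query sequence `σ`, when its
initial cache content is `B` (so its cache size is the number of elements of `B`). -/
noncomputable def optCost {N l : ℕ} (B : Finset (Fin N)) (σ : List (Query N l)) : ℕ :=
  sInf {n | ∃ C : ℕ → Finset (Fin N), IsOfflineSchedule B σ C ∧ missCount C σ = n}

/-!
The adversary works in phases. Let `S`, of size `h`, be the cache content of a fixed offline strategy
at the start of a phase. First come `n` bundles of fresh pages, which are new to this strategy and,
because `N` is large, nearly always new to the online algorithm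
(`RandomizedOnlineAlgorithm.exists_fresh_queries`); both sides pay about `n`. Let `W` consist of `S`
and of the `n * l` fresh pages. Then `h - n * l` pages of `S` are requested one at a time, each in a
bundle filled up with pages already requested in this phase. At least `D = h + n * l - k` pages of
`W` are always missing from the online cache. Repeating requests of pages that the phase has already
requested costs the offline strategy nothing and forces the online algorithm to keep them
(`RandomizedOnlineAlgorithm.exists_forcing_queries`). So, when `u` pages of `W` are still
unrequested, one of them is missing with probability almost `D / u`; it is requested next
(`RandomizedOnlineAlgorithm.exists_step`). The offline strategy evicts only pages that the phase
will not request, so it pays exactly `n` in the phase (`OfflineRun.of_fresh`, `OfflineRun.of_hits`),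
while the online algorithm pays almost `n + D * ∑ 1 / u`, where `u` runs from `n * l + 1` to `h`.

The sum is at least `log ((h + 1) / (n * l + 1))`, and with `g = k - h`,
`Y = log ((k + 1) / (g + l + 1))` and `n * l ≈ g * Y` the cost per fresh bundle exceeds the claimed
ratio strictly (`exists_number_of_fresh_bundles`); this slack absorbs the word "almost" above.

The optimal offline cost grows with the number of phases: a phase requests in total `h` pages, some of
them outside `S`, so an offline cache that starts at `S` must miss, and one that does not miss must
already equal the final content of the phase. A potential argument turns this into one miss for
every two phases (`OfflineRun.phase_lower_bound`).
-/

/-! ### Offline runs -/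

/-- `OfflineRun C σ D m`: an offline algorithm with initial cache content `C` can serve the queries
`σ` with exactly `m` misses and end with the cache content `D`. -/
inductive OfflineRun {N l : ℕ} :
    Finset (Fin N) → List (Query N l) → Finset (Fin N) → ℕ → Prop
  | nil (C : Finset (Fin N)) : OfflineRun C [] C 0
  | cons {C D E : Finset (Fin N)} {Q : Query N l} {σ : List (Query N l)} {m : ℕ} :
      CacheUpdate Q C D → OfflineRun D σ E m → OfflineRun C (Q :: σ) E (missCost C Q + m)

theorem CacheUpdate.card_eq {N l : ℕ} {Q : Query N l} {C D : Finset (Fin N)}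
    (hu : CacheUpdate Q C D) : D.card = C.card := by
  by_cases hQ : Q.pages ⊆ C
  · rw [hu.1 hQ]
  · exact (hu.2 hQ).2.2

namespace OfflineRun

variable {N l : ℕ} {C D E : Finset (Fin N)} {σ τ : List (Query N l)} {m m' : ℕ}

theorem append (h₁ : OfflineRun C σ D m) (h₂ : OfflineRun D τ E m') :
    OfflineRun C (σ ++ τ) E (m + m') := by
  induction h₁ with
  | nil => simpa using h₂
  | cons hu _ ih =>
    rw [Nat.add_assoc]
    exact OfflineRun.cons hu (ih h₂)

theorem exists_of_append (hr : OfflineRun C (σ ++ τ) E m) :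
    ∃ D m₁ m₂, OfflineRun C σ D m₁ ∧ OfflineRun D τ E m₂ ∧ m = m₁ + m₂ := by
  induction σ generalizing C m with
  | nil => exact ⟨C, 0, m, .nil C, hr, by simp⟩
  | cons Q σ ih =>
    cases hr with
    | cons hu hr =>
      obtain ⟨D, m₁, m₂, h₁, h₂, rfl⟩ := ih hr
      exact ⟨D, _, m₂, .cons hu h₁, h₂, by omega⟩

theorem card_eq (hr : OfflineRun C σ D m) : D.card = C.card := by
  induction hr with
  | nil => rfl
  | cons hu _ ih => rw [ih, hu.card_eq]

theorem of_no_miss (hr : OfflineRun C σ D m) (hm : m = 0) :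
    D = C ∧ ∀ Q ∈ σ, Q.pages ⊆ C := by
  induction hr with
  | nil => simp
  | @cons C D E Q σ m hu _ ih =>
    have hQ : Q.pages ⊆ C := by
      by_contra hQ
      simp [missCost, hQ] at hm
    obtain ⟨h₁, h₂⟩ := ih (by omega)
    rw [hu.1 hQ] at h₁ h₂
    exact ⟨h₁, by simpa using ⟨hQ, h₂⟩⟩

theorem of_hits (hσ : ∀ Q ∈ σ, Q.pages ⊆ C) : OfflineRun C σ C 0 := by
  induction σ with
  | nil => exact .nil C
  | cons Q σ ih =>
    have hQ : Q.pages ⊆ C := hσ Q (by simp)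
    have hr := OfflineRun.cons (Q := Q) (C := C) (D := C) (E := C)
      ⟨fun _ => rfl, fun hn => absurd hQ hn⟩ (ih fun Q' hQ' => hσ Q' (by simp [hQ']))
    simpa [missCost, hQ] using hr

theorem exists_schedule (hr : OfflineRun C σ D m) :
    ∃ c : ℕ → Finset (Fin N), IsOfflineSchedule C σ c ∧ missCount c σ = m := by
  induction hr with
  | nil C => exact ⟨fun _ => C, ⟨rfl, fun t => t.elim0⟩, rfl⟩
  | @cons C D E Q σ m hu _ ih =>
    obtain ⟨c, ⟨h0, hc⟩, hm⟩ := ih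
    refine ⟨fun t => Nat.casesOn t C c, ⟨rfl, ?_⟩, ?_⟩
    · intro t
      refine Fin.cases ?_ (fun t => ?_) t
      · simpa [h0] using hu
      · simpa using hc t
    · rw [← hm]
      exact Fin.sum_univ_succ _

theorem of_schedule (c : ℕ → Finset (Fin N)) (hc : IsOfflineSchedule C σ c) :
    OfflineRun C σ (c σ.length) (missCount c σ) := by
  induction σ generalizing C c with
  | nil =>
    rw [← hc.1]
    exact .nil _
  | cons Q σ ih =>
    have hr := ih (C := c 1) (fun t => c (t + 1)) ⟨rfl, fun t => by simpa using hc.2 t.succ⟩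
    have h0 := hc.2 0
    have he : missCount c (Q :: σ) = missCost C Q + missCount (fun t => c (t + 1)) σ := by
      rw [← hc.1]
      exact Fin.sum_univ_succ _
    rw [he]
    exact .cons (by simpa [hc.1] using h0) hr

/-- Loading bundles of `l` new pages each while a prescribed part `R` of the cache is kept costs one
miss for each bundle, if `R` leaves exactly enough room for the new pages. -/
theorem of_fresh (hl : 1 ≤ l) {R : Finset (Fin N)} (hR : R ⊆ C)
    (hcard : ∀ Q ∈ σ, Q.pages.card = l) (hd : ∀ Q ∈ σ, Disjoint Q.pages C)
    (hp : σ.Pairwise fun Q Q' => Disjoint Q.pages Q'.pages)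
    (hRC : R.card + σ.length * l = C.card) (hRD : R ⊆ D) (hσD : ∀ Q ∈ σ, Q.pages ⊆ D)
    (hD : D.card = C.card) : OfflineRun C σ D σ.length := by
  induction σ generalizing C R with
  | nil =>
    have h1 : R = C := Finset.eq_of_subset_of_card_le hR (by simpa using hRC.ge)
    have h2 : R = D := Finset.eq_of_subset_of_card_le hRD (by rw [hD, ← h1])
    rw [← h2, h1]
    exact .nil C
  | cons Q σ ih =>
    have hQ := hcard Q (by simp)
    have hQC := hd Q (by simp)
    rw [List.pairwise_cons] at hp
    have hlen : (Q :: σ).length * l = σ.length * l + l := by simp [Nat.succ_mul]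
    have hRQ : (R ∪ Q.pages).card = R.card + l := by
      rw [Finset.card_union_of_disjoint (hQC.symm.mono_left hR), hQ]
    obtain ⟨C', h1, h2, h3⟩ := Finset.exists_subsuperset_card_eq
      (Finset.union_subset_union hR (subset_refl Q.pages)) (n := C.card)
      (by omega) (Finset.card_le_card Finset.subset_union_left)
    have hns : ¬ Q.pages ⊆ C := fun hs => by
      have := Finset.card_eq_zero.2 (Finset.disjoint_self_iff_empty _ |>.1 (hQC.mono_right hs))
      omega
    have hu : CacheUpdate Q C C' :=
      ⟨fun hs => absurd hs hns, fun _ => ⟨Finset.subset_union_right.trans h1, h2, h3⟩⟩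
    have hr := ih h1 (fun Q' hQ' => hcard Q' (by simp [hQ']))
      (fun Q' hQ' => Disjoint.mono_right h2 (Finset.disjoint_union_right.2
        ⟨hd Q' (by simp [hQ']), (hp.1 Q' hQ').symm⟩)) hp.2 (by omega)
      (Finset.union_subset hRD (hσD Q (by simp))) (fun Q' hQ' => hσD Q' (by simp [hQ'])) (by omega)
    have := OfflineRun.cons hu hr
    simpa [missCost, hns, Nat.add_comm] using this

/-- The lower bound for the offline cost of one phase. If the queries `σ` contain a page outside `S`
and together fill `S'`, and all sets have the size of the cache, then a run without misses must
start away from `S` and end at `S'`. -/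
theorem phase_lower_bound {S S' : Finset (Fin N)} (hr : OfflineRun C σ D m)
    (hC : S'.card = C.card) (hnew : ∃ Q ∈ σ, ¬ Q.pages ⊆ S)
    (hfill : ∀ p ∈ S', ∃ Q ∈ σ, p ∈ Q.pages) :
    1 + (if D = S' then 0 else 1) ≤ 2 * m + (if C = S then 0 else 1) := by
  rcases Nat.eq_zero_or_pos m with rfl | hm
  · obtain ⟨hDC, hQ⟩ := hr.of_no_miss rfl
    have h1 : S' = C := Finset.eq_of_subset_of_card_le (fun p hp => by
      obtain ⟨Q, hQσ, hpQ⟩ := hfill p hp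
      exact hQ Q hQσ hpQ) hC.ge
    have h2 : C ≠ S := by
      rintro rfl
      obtain ⟨Q, hQσ, hn⟩ := hnew
      exact hn (hQ Q hQσ)
    simp [hDC, h1, h2]
  · split_ifs <;> omega

end OfflineRun

theorem optCost_le_of_run {N l : ℕ} {B D : Finset (Fin N)} {σ : List (Query N l)} {m : ℕ}
    (hr : OfflineRun B σ D m) : optCost B σ ≤ m :=
  Nat.sInf_le hr.exists_schedule

theorem exists_run_optCost {N l : ℕ} {B D : Finset (Fin N)} {σ : List (Query N l)} {m : ℕ}
    (hr : OfflineRun B σ D m) : ∃ D', OfflineRun B σ D' (optCost B σ) := by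
  obtain ⟨c, hc, hm⟩ := Nat.sInf_mem (s := {n | ∃ c : ℕ → Finset (Fin N),
    IsOfflineSchedule B σ c ∧ missCount c σ = n}) ⟨m, hr.exists_schedule⟩
  refine ⟨c σ.length, ?_⟩
  have := OfflineRun.of_schedule c hc
  rwa [hm] at this

/-! ### The expected cost of an online algorithm -/

theorem missCount_append_singleton {N l : ℕ} (c : ℕ → Finset (Fin N)) (σ : List (Query N l))
    (Q : Query N l) : missCount c (σ ++ [Q]) = missCount c σ + missCost (c σ.length) Q := by
  induction σ generalizing c with
  | nil => simp [missCount]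
  | cons Q' σ ih =>
    have hcons : ∀ τ : List (Query N l),
        missCount c (Q' :: τ) = missCost (c 0) Q' + missCount (fun t => c (t + 1)) τ := fun τ =>
      Fin.sum_univ_succ _
    rw [List.cons_append, hcons, hcons, ih, Nat.add_assoc]
    rfl

theorem OnlineAlgorithm.card_cache {N k l : ℕ} (A : OnlineAlgorithm N k l)
    (σ : List (Query N l)) : (A.cache σ).card = k := by
  induction σ using List.reverseRecOn with
  | nil => exact A.card_init
  | append_singleton σ Q ih => rw [(A.update σ Q).card_eq, ih]

theorem OnlineAlgorithm.cost_append_singleton {N k l : ℕ} (A : OnlineAlgorithm N k l)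
    (σ : List (Query N l)) (Q : Query N l) :
    A.cost (σ ++ [Q]) = A.cost σ + missCost (A.cache σ) Q := by
  unfold OnlineAlgorithm.cost
  rw [missCount_append_singleton]
  congr 1
  · refine Finset.sum_congr rfl fun t _ => ?_
    dsimp only
    rw [List.take_append_of_le_length t.2.le]
  · simp

/-- A bundle of `l` pages that contains `p` and otherwise pages of `P`. -/
theorem exists_query {N l : ℕ} (hl : 1 ≤ l) {P : Finset (Fin N)} {p : Fin N}
    (hP : l ≤ (insert p P).card) :
    ∃ Q : Query N l, p ∈ Q.pages ∧ Q.pages ⊆ insert p P ∧ Q.pages.card = l := by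
  obtain ⟨T, h1, h2, h3⟩ := Finset.exists_subsuperset_card_eq (s := {p}) (t := insert p P)
    (n := l) (by simp) (by simpa using hl) hP
  exact ⟨⟨T, ⟨p, h1 (by simp)⟩, h3.le⟩, h1 (by simp), h2, h3⟩

namespace RandomizedOnlineAlgorithm

variable {N k l : ℕ} {Ω : Type*} [MeasurableSpace Ω] (A : RandomizedOnlineAlgorithm N k l Ω)
  (μ : Measure Ω)

/-- The probability that the page `p` is not in the cache after the queries `σ`, written as the
expectation of an indicator. -/
noncomputable def missProb (σ : List (Query N l)) (p : Fin N) : ℝ :=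
  ∫ ω, (if p ∈ (A.alg ω).cache σ then 0 else 1 : ℝ) ∂μ

theorem integrable_cache [IsFiniteMeasure μ] (σ : List (Query N l)) (f : Finset (Fin N) → ℝ) :
    Integrable (fun ω => f ((A.alg ω).cache σ)) μ := by
  let _ : MeasurableSpace (Finset (Fin N)) := ⊤
  have hm : Measurable fun ω => (A.alg ω).cache σ :=
    measurable_to_countable' fun C => A.measurable_cache σ C
  exact (Integrable.of_finite (μ := μ.map fun ω => (A.alg ω).cache σ) (f := f)).comp_measurable hm

theorem integrable_cost [IsFiniteMeasure μ] (σ : List (Query N l)) :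
    Integrable (fun ω => ((A.alg ω).cost σ : ℝ)) μ := by
  induction σ using List.reverseRecOn with
  | nil =>
    have : ∀ ω, (A.alg ω).cost [] = 0 := fun ω => rfl
    simp [this]
  | append_singleton σ Q ih =>
    simp only [OnlineAlgorithm.cost_append_singleton, Nat.cast_add]
    exact ih.add (A.integrable_cache μ σ fun C => (missCost C Q : ℝ))

theorem expectedCost_nil : A.expectedCost μ [] = 0 := by
  have : ∀ ω, (A.alg ω).cost [] = 0 := fun ω => rfl
  simp [expectedCost, this]

theorem expectedCost_append_singleton [IsFiniteMeasure μ] (σ : List (Query N l)) (Q : Query N l) :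
    A.expectedCost μ (σ ++ [Q]) =
      A.expectedCost μ σ + ∫ ω, (missCost ((A.alg ω).cache σ) Q : ℝ) ∂μ := by
  simp only [expectedCost, OnlineAlgorithm.cost_append_singleton, Nat.cast_add]
  exact integral_add (A.integrable_cost μ σ)
    (A.integrable_cache μ σ fun C => (missCost C Q : ℝ))

theorem expectedCost_mono_append [IsFiniteMeasure μ] (σ τ : List (Query N l)) :
    A.expectedCost μ σ ≤ A.expectedCost μ (σ ++ τ) := by
  induction τ using List.reverseRecOn with
  | nil => simp
  | append_singleton τ Q ih =>
    rw [← List.append_assoc, expectedCost_append_singleton]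
    have : 0 ≤ ∫ ω, (missCost ((A.alg ω).cache (σ ++ τ)) Q : ℝ) ∂μ :=
      integral_nonneg fun ω => Nat.cast_nonneg _
    linarith

theorem expectedCost_nonneg (σ : List (Query N l)) : 0 ≤ A.expectedCost μ σ :=
  integral_nonneg fun _ => Nat.cast_nonneg _

theorem missProb_nonneg (σ : List (Query N l)) (p : Fin N) : 0 ≤ A.missProb μ σ p :=
  integral_nonneg fun ω => by dsimp only; split_ifs <;> simp

theorem add_missProb_le_expectedCost [IsFiniteMeasure μ] (σ : List (Query N l)) {Q : Query N l}
    {p : Fin N} (hp : p ∈ Q.pages) :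
    A.expectedCost μ σ + A.missProb μ σ p ≤ A.expectedCost μ (σ ++ [Q]) := by
  rw [expectedCost_append_singleton]
  gcongr
  refine integral_mono (A.integrable_cache μ σ fun C => if p ∈ C then 0 else 1)
    (A.integrable_cache μ σ fun C => (missCost C Q : ℝ)) fun ω => ?_
  dsimp only [missCost]
  by_cases h1 : p ∈ (A.alg ω).cache σ
  · simp only [h1, if_true]
    exact Nat.cast_nonneg _
  · simp [h1, show ¬ Q.pages ⊆ (A.alg ω).cache σ from fun hs => h1 (hs hp)]

/-- The cache holds only `k` pages, so at least `|V| - k` pages of `V` are missing from it. -/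
theorem card_sub_le_sum_missProb [IsProbabilityMeasure μ] (σ : List (Query N l))
    (V : Finset (Fin N)) : (V.card : ℝ) - k ≤ ∑ p ∈ V, A.missProb μ σ p := by
  unfold missProb
  rw [← integral_finsetSum _ fun p _ => A.integrable_cache μ σ fun C => if p ∈ C then 0 else 1]
  have hc : (V.card : ℝ) - k = ∫ _ : Ω, ((V.card : ℝ) - k) ∂μ := by simp
  rw [hc]
  refine integral_mono (integrable_const _)
    (A.integrable_cache μ σ fun C => ∑ p ∈ V, if p ∈ C then 0 else 1) fun ω => ?_
  dsimp only
  have h1 : V.card ≤ (V.filter fun p => p ∉ (A.alg ω).cache σ).card + k := by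
    have h3 := Finset.card_filter_add_card_filter_not (s := V) (fun p => p ∉ (A.alg ω).cache σ)
    have h4 : (V.filter fun p => ¬ p ∉ (A.alg ω).cache σ).card ≤ k := by
      refine (Finset.card_le_card fun p hp => ?_).trans ((A.alg ω).card_cache σ).le
      exact not_not.1 (Finset.mem_filter.1 hp).2
    omega
  have h2 : (∑ p ∈ V, if p ∈ (A.alg ω).cache σ then (0 : ℝ) else 1) =
      ((V.filter fun p => p ∉ (A.alg ω).cache σ).card : ℝ) := by
    rw [Finset.card_filter]
    push_cast
    exact Finset.sum_congr rfl fun p _ => by split_ifs <;> simp_all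
  rw [h2, sub_le_iff_le_add]
  exact_mod_cast h1

/-- Among many pages outside `U` there is one that is hardly ever in the cache. -/
theorem exists_fresh_query [IsProbabilityMeasure μ] (hl : 1 ≤ l) {δ : ℝ} (hδ : 0 < δ)
    (σ : List (Query N l)) (U : Finset (Fin N)) (hU : (k : ℝ) / δ + l + U.card ≤ N) :
    ∃ Q : Query N l, Q.pages.card = l ∧ Disjoint Q.pages U ∧
      A.expectedCost μ σ + (1 - δ) ≤ A.expectedCost μ (σ ++ [Q]) := by
  have hcard : ((Uᶜ.card : ℕ) : ℝ) = N - U.card := by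
    rw [Finset.card_compl, Fintype.card_fin, Nat.cast_sub]
    simpa using Finset.card_le_univ U
  have hk0 : (0 : ℝ) ≤ k / δ := by positivity
  have hl' : (1 : ℝ) ≤ l := by exact_mod_cast hl
  have hlU : l ≤ Uᶜ.card := by
    have : (l : ℝ) ≤ (Uᶜ.card : ℕ) := by rw [hcard]; linarith
    exact_mod_cast this
  have hpos : (0 : ℝ) < (Uᶜ.card : ℕ) := by rw [hcard]; linarith
  have hne : Uᶜ.Nonempty := Finset.card_pos.1 (by omega)
  obtain ⟨p, hp, hpm⟩ : ∃ p ∈ Uᶜ, 1 - δ ≤ A.missProb μ σ p := by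
    refine Finset.exists_le_of_sum_le hne (le_trans ?_ (A.card_sub_le_sum_missProb μ σ Uᶜ))
    have h1 : (k : ℝ) / δ ≤ (Uᶜ.card : ℕ) := by rw [hcard]; linarith
    rw [div_le_iff₀ hδ] at h1
    rw [Finset.sum_const, nsmul_eq_mul]
    linarith
  have hins : insert p Uᶜ = Uᶜ := Finset.insert_eq_of_mem hp
  obtain ⟨Q, hpQ, hQ, hQl⟩ := exists_query hl (p := p) (P := Uᶜ) (by rw [hins]; exact hlU)
  rw [hins] at hQ
  refine ⟨Q, hQl, ?_, ?_⟩
  · exact Finset.disjoint_left.2 fun q hq hqU => Finset.mem_compl.1 (hQ hq) hqU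
  · have := A.add_missProb_le_expectedCost μ σ hpQ
    linarith

/-- Requesting pages of `P` again and again either becomes arbitrarily expensive for the online
algorithm, or forces it to keep almost all of `P` in its cache. -/
theorem exists_forcing_queries [IsFiniteMeasure μ] (hl : 1 ≤ l) {δ : ℝ} (hδ : 0 < δ)
    (σ : List (Query N l)) (P : Finset (Fin N)) (hP : l ≤ P.card) (K : ℝ) :
    ∃ ρ : List (Query N l), (∀ Q ∈ ρ, Q.pages.card = l ∧ Q.pages ⊆ P) ∧
      (A.expectedCost μ σ + K ≤ A.expectedCost μ (σ ++ ρ) ∨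
        ∑ p ∈ P, A.missProb μ (σ ++ ρ) p ≤ δ) := by
  have hPpos : 0 < (P.card : ℝ) := by exact_mod_cast (by omega : 0 < P.card)
  have key : ∀ i : ℕ, ∃ ρ : List (Query N l), (∀ Q ∈ ρ, Q.pages.card = l ∧ Q.pages ⊆ P) ∧
      (A.expectedCost μ σ + i * (δ / P.card) ≤ A.expectedCost μ (σ ++ ρ) ∨
        ∑ p ∈ P, A.missProb μ (σ ++ ρ) p ≤ δ) := by
    intro i
    induction i with
    | zero => exact ⟨[], by simp, Or.inl (by simp)⟩
    | succ i ih =>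
      obtain ⟨ρ, hρ, h1 | h1⟩ := ih
      · by_cases h2 : ∑ p ∈ P, A.missProb μ (σ ++ ρ) p ≤ δ
        · exact ⟨ρ, hρ, Or.inr h2⟩
        · obtain ⟨p, hp, hpm⟩ : ∃ p ∈ P, δ / P.card ≤ A.missProb μ (σ ++ ρ) p := by
            refine Finset.exists_le_of_sum_le (Finset.card_pos.1 (by omega)) ?_
            rw [Finset.sum_const, nsmul_eq_mul, mul_div_cancel₀ _ hPpos.ne']
            exact (not_le.1 h2).le
          have hins : insert p P = P := Finset.insert_eq_of_mem hp
          obtain ⟨Q, hpQ, hQ, hQl⟩ := exists_query hl (p := p) (P := P) (by rwa [hins])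
          refine ⟨ρ ++ [Q], ?_, Or.inl ?_⟩
          · intro Q' hQ'
            rcases List.mem_append.1 hQ' with hQ' | hQ'
            · exact hρ Q' hQ'
            · rw [List.mem_singleton.1 hQ']
              exact ⟨hQl, hins ▸ hQ⟩
          · have := A.add_missProb_le_expectedCost μ (σ ++ ρ) hpQ
            rw [← List.append_assoc]
            push_cast
            linarith
      · exact ⟨ρ, hρ, Or.inr h1⟩
  obtain ⟨i, hi⟩ := exists_nat_ge (K / (δ / P.card))
  rw [div_le_iff₀ (by positivity)] at hi
  obtain ⟨ρ, hρ, h1 | h1⟩ := key i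
  · exact ⟨ρ, hρ, Or.inl (by linarith)⟩
  · exact ⟨ρ, hρ, Or.inr h1⟩

/-- The step from `P` to `P ∪ {p}` in a phase with the page set `W`. At least `|W| - k` pages of `W`
are missing from the cache. If nearly all of them lie outside `P`, a page outside `P` that is missing
with at least average probability is requested together with pages of `P`; otherwise requests
inside `P` have already been expensive enough. -/
theorem exists_step [IsProbabilityMeasure μ] (hl : 1 ≤ l) {δ : ℝ} (hδ : 0 < δ)
    (σ : List (Query N l)) {P W : Finset (Fin N)} (hPW : P ⊂ W) (hP : l ≤ P.card) :
    ∃ (ρ : List (Query N l)) (p : Fin N), p ∈ W \ P ∧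
      (∀ Q ∈ ρ, Q.pages.card = l ∧ Q.pages ⊆ insert p P) ∧ (∃ Q ∈ ρ, p ∈ Q.pages) ∧
      A.expectedCost μ σ + (((W.card - k : ℕ) : ℝ) - δ) / ((W.card : ℝ) - P.card) ≤
        A.expectedCost μ (σ ++ ρ) := by
  set K := (((W.card - k : ℕ) : ℝ) - δ) / ((W.card : ℝ) - P.card) with hK
  have hcard : (((W \ P).card : ℕ) : ℝ) = (W.card : ℝ) - P.card := by
    rw [Finset.card_sdiff_of_subset hPW.1, Nat.cast_sub (Finset.card_le_card hPW.1)]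
  have hne : (W \ P).Nonempty := Finset.sdiff_nonempty.2 hPW.2
  have hpos : 0 < (W.card : ℝ) - P.card := by
    rw [← hcard]
    exact_mod_cast Finset.card_pos.2 hne
  obtain ⟨ρ, hρ, hcase⟩ := A.exists_forcing_queries μ hl hδ σ P hP K
  obtain ⟨p, hp, hpm⟩ : ∃ p ∈ W \ P, A.expectedCost μ σ + K ≤
      A.expectedCost μ (σ ++ ρ) + A.missProb μ (σ ++ ρ) p := by
    rcases hcase with h1 | h1
    · obtain ⟨p, hp⟩ := hne
      have := A.missProb_nonneg μ (σ ++ ρ) p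
      exact ⟨p, hp, by linarith⟩
    · obtain ⟨p, hp, hpm⟩ : ∃ p ∈ W \ P, K ≤ A.missProb μ (σ ++ ρ) p := by
        refine Finset.exists_le_of_sum_le hne ?_
        rw [Finset.sum_const, nsmul_eq_mul, hcard, hK, mul_div_cancel₀ _ hpos.ne',
          sub_le_iff_le_add]
        have h2 := A.card_sub_le_sum_missProb μ (σ ++ ρ) W
        rw [← Finset.sum_sdiff hPW.1] at h2
        have h3 : 0 ≤ ∑ p ∈ W \ P, A.missProb μ (σ ++ ρ) p :=
          Finset.sum_nonneg fun p _ => A.missProb_nonneg μ _ p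
        rcases le_total k W.card with hk | hk
        · rw [Nat.cast_sub hk]
          linarith
        · rw [Nat.sub_eq_zero_of_le hk, Nat.cast_zero]
          linarith
      have := A.expectedCost_mono_append μ σ ρ
      exact ⟨p, hp, by linarith⟩
  obtain ⟨Q, hpQ, hQ, hQl⟩ := exists_query hl (p := p) (P := P)
    (hP.trans (Finset.card_le_card (Finset.subset_insert p P)))
  refine ⟨ρ ++ [Q], p, hp, ?_, ⟨Q, by simp, hpQ⟩, ?_⟩
  · intro Q' hQ'
    rcases List.mem_append.1 hQ' with hQ' | hQ'
    · exact ⟨(hρ Q' hQ').1, (hρ Q' hQ').2.trans (Finset.subset_insert p P)⟩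
    · rw [List.mem_singleton.1 hQ']
      exact ⟨hQl, hQ⟩
  · have := A.add_missProb_le_expectedCost μ (σ ++ ρ) hpQ
    rw [← List.append_assoc]
    linarith

/-- The second part of a phase: `i` steps, each of which adds a page of `W` to `P`. -/
theorem exists_steps [IsProbabilityMeasure μ] (hl : 1 ≤ l) {δ : ℝ} (hδ : 0 < δ)
    (σ : List (Query N l)) {P W : Finset (Fin N)} (hPW : P ⊆ W) (hP : l ≤ P.card) (i : ℕ)
    (hi : P.card + i ≤ W.card) :
    ∃ (ρ : List (Query N l)) (P' : Finset (Fin N)), P ⊆ P' ∧ P' ⊆ W ∧ P'.card = P.card + i ∧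
      (∀ Q ∈ ρ, Q.pages.card = l ∧ Q.pages ⊆ P') ∧ (∀ p ∈ P', p ∉ P → ∃ Q ∈ ρ, p ∈ Q.pages) ∧
      A.expectedCost μ σ + (((W.card - k : ℕ) : ℝ) - δ) *
          ∑ t ∈ Finset.range i, 1 / ((W.card : ℝ) - P.card - t) ≤
        A.expectedCost μ (σ ++ ρ) := by
  induction i with
  | zero => exact ⟨[], P, subset_rfl, hPW, rfl, by simp, fun p h1 h2 => absurd h1 h2, by simp⟩
  | succ i ih =>
    obtain ⟨ρ, P', h1, h2, h3, h4, h5, h6⟩ := ih (by omega)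
    have hss : P' ⊂ W := Finset.ssubset_iff_subset_ne.2 ⟨h2, by rintro rfl; omega⟩
    obtain ⟨ρ', p, hp, h7, h8, h9⟩ := A.exists_step μ hl hδ (σ ++ ρ) hss (by omega)
    rw [Finset.mem_sdiff] at hp
    refine ⟨ρ ++ ρ', insert p P', h1.trans (Finset.subset_insert _ _),
      Finset.insert_subset hp.1 h2, by rw [Finset.card_insert_of_notMem hp.2, h3]; ring, ?_, ?_, ?_⟩
    · intro Q hQ
      rcases List.mem_append.1 hQ with hQ | hQ
      · exact ⟨(h4 Q hQ).1, (h4 Q hQ).2.trans (Finset.subset_insert _ _)⟩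
      · exact h7 Q hQ
    · intro q hq hqP
      rcases Finset.mem_insert.1 hq with rfl | hq
      · obtain ⟨Q, hQ, hqQ⟩ := h8
        exact ⟨Q, by simp [hQ], hqQ⟩
      · obtain ⟨Q, hQ, hqQ⟩ := h5 q hq hqP
        exact ⟨Q, by simp [hQ], hqQ⟩
    · rw [← List.append_assoc, Finset.sum_range_succ, mul_add, mul_one_div, ← add_assoc]
      have : (W.card : ℝ) - P.card - i = (W.card : ℝ) - P'.card := by
        rw [h3]; push_cast; ring
      rw [this]
      linarith

/-- The first part of a phase: `n` bundles of pages that are new with respect to `S`, to each other,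
and nearly always to the cache of the online algorithm. -/
theorem exists_fresh_queries [IsProbabilityMeasure μ] (hl : 1 ≤ l) {δ : ℝ} (hδ : 0 < δ)
    (σ : List (Query N l)) (S : Finset (Fin N)) (n : ℕ)
    (hN : (k : ℝ) / δ + l + (S.card + n * l : ℕ) ≤ N) :
    ∃ (ρ : List (Query N l)) (T : Finset (Fin N)), ρ.length = n ∧ Disjoint T S ∧
      T.card = n * l ∧ (∀ Q ∈ ρ, Q.pages.card = l ∧ Q.pages ⊆ T) ∧
      (∀ p ∈ T, ∃ Q ∈ ρ, p ∈ Q.pages) ∧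
      (ρ.Pairwise fun Q Q' => Disjoint Q.pages Q'.pages) ∧
      A.expectedCost μ σ + n * (1 - δ) ≤ A.expectedCost μ (σ ++ ρ) := by
  induction n with
  | zero => exact ⟨[], ∅, by simp⟩
  | succ n ih =>
    have hle : ((S.card + n * l : ℕ) : ℝ) ≤ (S.card + (n + 1) * l : ℕ) := by
      gcongr
      omega
    obtain ⟨ρ, T, h1, h2, h3, h4, h5, h6, h7⟩ := ih (by linarith)
    obtain ⟨Q, hQl, hQ, hQc⟩ := A.exists_fresh_query μ hl hδ (σ ++ ρ) (S ∪ T) (by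
      rw [Finset.card_union_of_disjoint h2.symm, h3]
      linarith)
    rw [Finset.disjoint_union_right] at hQ
    refine ⟨ρ ++ [Q], T ∪ Q.pages, by simp [h1], Finset.disjoint_union_left.2 ⟨h2, hQ.1⟩, ?_, ?_,
      ?_, ?_, ?_⟩
    · rw [Finset.card_union_of_disjoint hQ.2.symm, h3, hQl]
      ring
    · intro Q' hQ'
      rcases List.mem_append.1 hQ' with hQ' | hQ'
      · exact ⟨(h4 Q' hQ').1, (h4 Q' hQ').2.trans Finset.subset_union_left⟩
      · rw [List.mem_singleton.1 hQ']
        exact ⟨hQl, Finset.subset_union_right⟩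
    · intro p hp
      rcases Finset.mem_union.1 hp with hp | hp
      · obtain ⟨Q', hQ', hpQ⟩ := h5 p hp
        exact ⟨Q', by simp [hQ'], hpQ⟩
      · exact ⟨Q, by simp, hp⟩
    · rw [List.pairwise_append]
      refine ⟨h6, List.pairwise_singleton _ _, fun Q' hQ' Q'' hQ'' => ?_⟩
      rw [List.mem_singleton.1 hQ'']
      exact hQ.2.symm.mono_left (h4 Q' hQ').2
    · rw [← List.append_assoc]
      push_cast
      linarith

end RandomizedOnlineAlgorithm

/-! ### The choice of the number of fresh bundles -/

theorem log_div_le_sum_inv (m i : ℕ) :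
    Real.log (((m + i : ℕ) + 1 : ℝ) / (m + 1)) ≤
      ∑ t ∈ Finset.range i, 1 / (((m + i : ℕ) : ℝ) - t) := by
  induction i with
  | zero => simp [div_self (by positivity : (m : ℝ) + 1 ≠ 0)]
  | succ i ih =>
    rw [Finset.sum_range_succ']
    have h1 : ∑ t ∈ Finset.range i, 1 / (((m + (i + 1) : ℕ) : ℝ) - ((t + 1 : ℕ) : ℝ)) =
        ∑ t ∈ Finset.range i, 1 / (((m + i : ℕ) : ℝ) - t) := by
      refine Finset.sum_congr rfl fun t _ => ?_
      push_cast
      congr 1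
      ring
    rw [h1]
    have hpos : (0 : ℝ) < m + i + 1 := by positivity
    have h2 : (((m + (i + 1) : ℕ) : ℝ) + 1) / (m + 1) =
        (((m + i : ℕ) + 1 : ℝ) / (m + 1)) * (1 + 1 / (m + i + 1)) := by
      push_cast
      field_simp
      ring
    rw [h2, Real.log_mul (by positivity) (by positivity)]
    have h3 := Real.log_le_sub_one_of_pos (by positivity : (0 : ℝ) < 1 + 1 / (m + i + 1))
    push_cast at ih ⊢
    have h4 : (1 : ℝ) / (m + (i + 1) - 0) = 1 / (m + i + 1) := by ring_nf
    rw [h4]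
    linarith

/-- For `1 / 5 ≤ Y ≤ 1`, the claimed ratio is below `1`, so the nontrivial case has `Y > 1`. -/
theorem sub_log_lt_two {Y : ℝ} (h0 : 1 / 5 ≤ Y) (h1 : Y ≤ 1) : Y - Real.log Y < 2 := by
  have hY : 0 < Y := by linarith
  have h2 : Real.exp (Y - 2) < Y := by
    have hexp := Real.abs_exp_sub_one_sub_id_le (x := Y) (by rw [abs_of_pos hY]; exact h1)
    have hle : Real.exp Y ≤ 1 + Y + Y ^ 2 := by linarith [(abs_le.1 hexp).2]
    have he : (7 : ℝ) < Real.exp 2 := by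
      have : Real.exp 2 = Real.exp 1 * Real.exp 1 := by rw [← Real.exp_add]; norm_num
      rw [this]
      nlinarith [Real.exp_one_gt_d9]
    rw [Real.exp_sub, div_lt_iff₀ (by linarith)]
    nlinarith
  have := Real.log_lt_log (Real.exp_pos _) h2
  rw [Real.log_exp] at this
  linarith

/-- The parameters of a phase: `n` bundles of fresh pages, such that the cost that the phase forces
on the online algorithm exceeds `n` times the claimed ratio. With `g = k - h` and
`Y = log ((k + 1) / (g + l + 1))` the good choice is `n * l ≈ g * Y`, unless `Y - log Y` is below
`2` and the claimed ratio is below `1`. The subtraction `h + n * l - k` is the truncated one. -/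
theorem exists_number_of_fresh_bundles (h k l : ℕ) (hl : 1 ≤ l) (hlh : 2 * l ≤ h) (hhk : h ≤ k)
    (hratio : h = k ∨ Real.exp 1 ≤ (k : ℝ) / ((k : ℝ) - (h : ℝ))) :
    ∃ n : ℕ, 1 ≤ n ∧ n * l ≤ h ∧
      ((l : ℝ) * Real.log (((k : ℝ) + 1) / ((k : ℝ) - (h : ℝ) + (l : ℝ) + 1))
            - (l : ℝ) * Real.log (Real.log (((k : ℝ) + 1) / ((k : ℝ) - (h : ℝ) + (l : ℝ) + 1)))
            - 2 * (l : ℝ) + 1) * n <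
        n + ((h + n * l - k : ℕ) : ℝ) * ∑ t ∈ Finset.range (h - n * l), 1 / ((h : ℝ) - t) := by
  have hl' : (1 : ℝ) ≤ l := by exact_mod_cast hl
  have hlh' : 2 * (l : ℝ) ≤ h := by exact_mod_cast hlh
  have hhk' : (h : ℝ) ≤ k := by exact_mod_cast hhk
  have he1 := Real.exp_one_gt_d9
  have he2 := Real.exp_one_lt_d9
  have hg : Real.exp 1 * ((k : ℝ) - h) ≤ k := by
    rcases hratio with rfl | hr
    · simp
    · rcases hhk'.eq_or_lt with heq | hlt
      · rw [heq]; simp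
      · rwa [le_div_iff₀ (by linarith)] at hr
  set a : ℝ := (k : ℝ) - h + l + 1 with ha
  have hapos : 0 < a := by linarith
  set Y : ℝ := Real.log (((k : ℝ) + 1) / a) with hYdef
  have hY5 : 1 / 5 ≤ Y := by
    have h1 := Real.one_sub_inv_le_log_of_pos (by positivity : 0 < ((k : ℝ) + 1) / a)
    refine le_trans ?_ h1
    rw [inv_div, le_sub_comm, div_le_iff₀ (by positivity)]
    nlinarith
  have hsum : ∀ n : ℕ, 0 ≤ ∑ t ∈ Finset.range (h - n * l), 1 / ((h : ℝ) - t) := fun n =>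
    Finset.sum_nonneg fun t ht => by
      have : (t : ℝ) ≤ h := by
        exact_mod_cast ((Finset.mem_range.1 ht).trans_le (Nat.sub_le _ _)).le
      exact div_nonneg zero_le_one (by linarith)
  rcases lt_or_ge (Y - Real.log Y) 2 with hlt | hge
  · refine ⟨1, le_rfl, by omega, ?_⟩
    have h1 : (0 : ℝ) ≤ ((h + 1 * l - k : ℕ) : ℝ) *
        ∑ t ∈ Finset.range (h - 1 * l), 1 / ((h : ℝ) - t) :=
      mul_nonneg (Nat.cast_nonneg _) (hsum 1)
    push_cast at h1 ⊢
    nlinarith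
  · have hY1 : 1 < Y := by
      by_contra hle
      exact absurd (sub_log_lt_two hY5 (not_lt.1 hle)) (not_lt.2 hge)
    set g : ℝ := (k : ℝ) - h with hgdef
    have hg0 : 0 ≤ g := by linarith
    obtain ⟨n, hn1, hnl, hnu⟩ : ∃ n : ℕ, 1 ≤ n ∧ g * Y ≤ n * l ∧ (n : ℝ) * l ≤ g * Y + l := by
      rcases hg0.eq_or_lt with hz | hp
      · exact ⟨1, le_rfl, by rw [← hz]; simp, by rw [← hz]; simp⟩
      · refine ⟨⌈g * Y / l⌉₊, Nat.one_le_ceil_iff.2 (by positivity), ?_, ?_⟩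
        · rw [← div_le_iff₀ (by linarith)]
          exact Nat.le_ceil _
        · have := (Nat.ceil_lt_add_one (by positivity : 0 ≤ g * Y / l)).le
          have h2 := mul_le_mul_of_nonneg_right this (by linarith : (0 : ℝ) ≤ l)
          rwa [add_mul, div_mul_cancel₀ _ (by linarith), one_mul] at h2
    have hn1' : (1 : ℝ) ≤ n := by exact_mod_cast hn1
    have hnpos : 0 < (n : ℝ) * l := by nlinarith
    have hmY : (n : ℝ) * l + 1 ≤ a * Y := by nlinarith
    -- Replacing `k + 1` by `h + 1` loses less than `1`, since `h ≥ (1 - 1 / e) k`.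
    have hr : Real.log (((k : ℝ) + 1) / (h + 1)) < 1 := by
      rw [Real.log_lt_iff_lt_exp (by positivity), div_lt_iff₀ (by positivity)]
      nlinarith
    have hlog : Real.log (((h : ℝ) + 1) / (a * Y)) =
        Y - Real.log Y - Real.log (((k : ℝ) + 1) / (h + 1)) := by
      have h1 : Y = Real.log ((k : ℝ) + 1) - Real.log a := by
        rw [hYdef, Real.log_div (by positivity) hapos.ne']
      rw [Real.log_div (by positivity) (by positivity), Real.log_mul hapos.ne' (by linarith),
        Real.log_div (by positivity) (by positivity)]
      linarith
    set r := Real.log (((k : ℝ) + 1) / (h + 1)) with hrdef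
    have hr0 : 0 ≤ r := Real.log_nonneg (by rw [le_div_iff₀ (by positivity)]; linarith)
    have hnh : n * l ≤ h := by
      have h1 : 0 < Real.log (((h : ℝ) + 1) / (a * Y)) := by rw [hlog]; linarith
      have h2 : 1 < ((h : ℝ) + 1) / (a * Y) := by
        by_contra hle
        exact absurd (Real.log_nonpos (by positivity) (not_lt.1 hle)) (not_le.2 h1)
      rw [lt_div_iff₀ (by positivity)] at h2
      have : (n : ℝ) * l ≤ h := by linarith
      exact_mod_cast this
    refine ⟨n, hn1, hnh, ?_⟩
    have hD : (n : ℝ) * l - g ≤ ((h + n * l - k : ℕ) : ℝ) := by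
      rw [hgdef, sub_le_iff_le_add]
      have : h + n * l ≤ (h + n * l - k) + k := by omega
      have : (h : ℝ) + n * l ≤ ((h + n * l - k : ℕ) : ℝ) + k := by exact_mod_cast this
      linarith
    have hS : Y - Real.log Y - r ≤ ∑ t ∈ Finset.range (h - n * l), 1 / ((h : ℝ) - t) := by
      have h1 := log_div_le_sum_inv (n * l) (h - n * l)
      rw [Nat.add_sub_cancel' hnh] at h1
      refine le_trans ?_ h1
      rw [← hlog]
      push_cast
      gcongr
    set H := ∑ t ∈ Finset.range (h - n * l), 1 / ((h : ℝ) - t) with hH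
    have hlY : 0 < Real.log Y := Real.log_pos hY1
    have hgY : g * (Y - Real.log Y - r) ≤ n * l * (1 - (Real.log Y + r) / Y) := by
      have : g * (Y - Real.log Y - r) = g * Y * (1 - (Real.log Y + r) / Y) := by
        field_simp
        ring
      rw [this]
      refine mul_le_mul_of_nonneg_right hnl ?_
      rw [sub_nonneg, div_le_one (by linarith)]
      linarith
    have hq : 0 ≤ (Real.log Y + r) / Y := by positivity
    have hng : 0 ≤ (n : ℝ) * l - g := by nlinarith
    have hmain : ((n : ℝ) * l - g) * (Y - Real.log Y - r) ≤
        ((h + n * l - k : ℕ) : ℝ) * H :=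
      mul_le_mul hD hS (by linarith) (Nat.cast_nonneg _)
    have h1 : (n : ℝ) * l * r < n * l := by nlinarith
    have h2 : 0 ≤ (n : ℝ) * l * ((Real.log Y + r) / Y) := mul_nonneg hnpos.le hq
    linarith

/-! ### Phases -/

namespace RandomizedOnlineAlgorithm

variable {N k l : ℕ} {Ω : Type*} [MeasurableSpace Ω] (A : RandomizedOnlineAlgorithm N k l Ω)
  (μ : Measure Ω)

/-- One phase, which starts and ends with the offline cache contents `S` and `S'`. -/
theorem exists_phase [IsProbabilityMeasure μ] (hl : 1 ≤ l) {h n : ℕ} (hn : 1 ≤ n)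
    (hnh : n * l ≤ h) {δ : ℝ} (hδ : 0 < δ) (hN : (k : ℝ) / δ + l + (h + n * l : ℕ) ≤ N)
    (σ : List (Query N l)) (S : Finset (Fin N)) (hS : S.card = h) :
    ∃ (ρ : List (Query N l)) (S' : Finset (Fin N)), S'.card = h ∧ (∀ Q ∈ ρ, Q.pages.card = l) ∧
      OfflineRun S ρ S' n ∧ (∃ Q ∈ ρ, ¬ Q.pages ⊆ S) ∧ (∀ p ∈ S', ∃ Q ∈ ρ, p ∈ Q.pages) ∧
      A.expectedCost μ σ + n * (1 - δ) + (((h + n * l - k : ℕ) : ℝ) - δ) *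
          ∑ t ∈ Finset.range (h - n * l), 1 / ((h : ℝ) - t) ≤
        A.expectedCost μ (σ ++ ρ) := by
  obtain ⟨ρ, T, h1, h2, h3, h4, h5, h6, h7⟩ :=
    A.exists_fresh_queries μ hl hδ σ S n (by rwa [hS])
  have hW : (S ∪ T).card = h + n * l := by
    rw [Finset.card_union_of_disjoint h2.symm, hS, h3]
  have hlT : l ≤ T.card := by rw [h3]; exact Nat.le_mul_of_pos_left l hn
  obtain ⟨ρ', S', g1, g2, g3, g4, g5, g6⟩ := A.exists_steps μ hl hδ (σ ++ ρ)
    (Finset.subset_union_right (s₁ := S) (s₂ := T)) hlT (h - n * l) (by omega)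
  have hS' : S'.card = h := by omega
  refine ⟨ρ ++ ρ', S', hS', ?_, ?_, ?_, ?_, ?_⟩
  · intro Q hQ
    rcases List.mem_append.1 hQ with hQ | hQ
    · exact (h4 Q hQ).1
    · exact (g4 Q hQ).1
  · -- The offline algorithm evicts the old pages that the phase will not request.
    have hRT : (S' \ T).card + T.card = S'.card := by
      rw [Finset.card_sdiff_of_subset g1]
      exact Nat.sub_add_cancel (Finset.card_le_card g1)
    have hr := OfflineRun.of_fresh hl (R := S' \ T) (C := S) (D := S') (σ := ρ)
      (fun p hp => by
        rw [Finset.mem_sdiff] at hp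
        exact (Finset.mem_union.1 (g2 hp.1)).resolve_right hp.2)
      (fun Q hQ => (h4 Q hQ).1) (fun Q hQ => h2.mono_left (h4 Q hQ).2) h6
      (by rw [h1, ← h3]; omega) Finset.sdiff_subset (fun Q hQ => (h4 Q hQ).2.trans g1) (by omega)
    rw [h1] at hr
    simpa using hr.append (OfflineRun.of_hits fun Q hQ => (g4 Q hQ).2)
  · obtain ⟨p, hp⟩ : T.Nonempty := Finset.card_pos.1 (by omega)
    obtain ⟨Q, hQ, hpQ⟩ := h5 p hp
    exact ⟨Q, by simp [hQ], fun hs => Finset.disjoint_left.1 h2 hp (hs hpQ)⟩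
  · intro p hp
    by_cases hpT : p ∈ T
    · obtain ⟨Q, hQ, hpQ⟩ := h5 p hpT
      exact ⟨Q, by simp [hQ], hpQ⟩
    · obtain ⟨Q, hQ, hpQ⟩ := g5 p hp hpT
      exact ⟨Q, by simp [hQ], hpQ⟩
  · rw [hW, h3] at g6
    have : ((h + n * l : ℕ) : ℝ) - ((n * l : ℕ) : ℝ) = h := by push_cast; ring
    rw [this] at g6
    rw [← List.append_assoc]
    linarith

/-- A sequence of `r` phases. The term `if D = S then 0 else 1` carries the lower bound for the
offline cost from one phase to the next. -/
theorem exists_phases [IsProbabilityMeasure μ] (hl : 1 ≤ l) {h n : ℕ} (hn : 1 ≤ n)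
    (hnh : n * l ≤ h) {δ c : ℝ} (hδ : 0 < δ) (hN : (k : ℝ) / δ + l + (h + n * l : ℕ) ≤ N)
    (hc : c * n ≤ n * (1 - δ) + (((h + n * l - k : ℕ) : ℝ) - δ) *
      ∑ t ∈ Finset.range (h - n * l), 1 / ((h : ℝ) - t))
    (B : Finset (Fin N)) (hB : B.card = h) (r : ℕ) :
    ∃ (σ : List (Query N l)) (S : Finset (Fin N)), S.card = h ∧ (∀ Q ∈ σ, Q.pages.card = l) ∧
      OfflineRun B σ S (n * r) ∧
      (∀ D m, OfflineRun B σ D m → r + (if D = S then 0 else 1) ≤ 2 * m) ∧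
      c * (n * r) ≤ A.expectedCost μ σ := by
  induction r with
  | zero =>
    refine ⟨[], B, hB, by simp, .nil B, fun D m hr => ?_, by simp [expectedCost_nil]⟩
    cases hr
    simp
  | succ r ih =>
    obtain ⟨σ, S, h1, h2, h3, h4, h5⟩ := ih
    obtain ⟨ρ, S', g1, g2, g3, g4, g5, g6⟩ := A.exists_phase μ hl hn hnh hδ hN σ S h1
    refine ⟨σ ++ ρ, S', g1, ?_, h3.append g3, ?_, ?_⟩
    · intro Q hQ
      rcases List.mem_append.1 hQ with hQ | hQ
      · exact h2 Q hQ
      · exact g2 Q hQ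
    · intro E m hr
      obtain ⟨D, m₁, m₂, r1, r2, rfl⟩ := hr.exists_of_append
      have a1 := h4 D m₁ r1
      have a2 := r2.phase_lower_bound (by rw [g1, r1.card_eq, hB]) g4 g5
      omega
    · push_cast
      linarith

end RandomizedOnlineAlgorithm

theorem theorem3 (h k l : ℕ) (hl : 1 ≤ l) (hlh : 2 * l ≤ h) (hhk : h ≤ k)
    (hratio : h = k ∨ Real.exp 1 ≤ (k : ℝ) / ((k : ℝ) - (h : ℝ))) :
    ∃ N₀ : ℕ, ∀ N : ℕ, N₀ ≤ N →
      ∀ (Ω : Type*) [MeasurableSpace Ω] (μ : Measure Ω) [IsProbabilityMeasure μ]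
        (A : RandomizedOnlineAlgorithm N k l Ω) (B : Finset (Fin N)), B.card = h →
      ∀ M : ℕ, ∃ σ : List (Query N l),
        (∀ Q ∈ σ, Q.pages.card = l) ∧
        M < optCost B σ ∧
        (l : ℝ) * Real.log (((k : ℝ) + 1) / ((k : ℝ) - (h : ℝ) + (l : ℝ) + 1))
            - (l : ℝ) * Real.log (Real.log (((k : ℝ) + 1) / ((k : ℝ) - (h : ℝ) + (l : ℝ) + 1)))
            - 2 * (l : ℝ) + 1
          ≤ A.expectedCost μ σ / (optCost B σ : ℝ) := by
  obtain ⟨n, hn, hnh, hlt⟩ := exists_number_of_fresh_bundles h k l hl hlh hhk hratio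
  set c : ℝ := (l : ℝ) * Real.log (((k : ℝ) + 1) / ((k : ℝ) - (h : ℝ) + (l : ℝ) + 1))
    - (l : ℝ) * Real.log (Real.log (((k : ℝ) + 1) / ((k : ℝ) - (h : ℝ) + (l : ℝ) + 1)))
    - 2 * (l : ℝ) + 1
  set H : ℝ := ∑ t ∈ Finset.range (h - n * l), 1 / ((h : ℝ) - t) with hH
  have hH0 : 0 ≤ H := Finset.sum_nonneg fun t ht => by
    have : (t : ℝ) ≤ h := by
      exact_mod_cast ((Finset.mem_range.1 ht).trans_le (Nat.sub_le _ _)).le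
    exact div_nonneg zero_le_one (by linarith)
  have hnpos : (0 : ℝ) < n := by exact_mod_cast hn
  -- The slack in the choice of `n` pays for all the errors of size `δ`.
  obtain ⟨δ, hδ, hδeq⟩ : ∃ δ : ℝ, 0 < δ ∧
      δ * (n + H) = n + ((h + n * l - k : ℕ) : ℝ) * H - c * n :=
    ⟨_, div_pos (sub_pos.2 hlt) (by positivity : 0 < n + H), div_mul_cancel₀ _ (by positivity)⟩
  obtain ⟨N₀, hN₀⟩ := exists_nat_ge ((k : ℝ) / δ + l + (h + n * l : ℕ))
  refine ⟨N₀, fun N hN Ω _ μ _ A B hB M => ?_⟩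
  have hN' : (N₀ : ℝ) ≤ N := by exact_mod_cast hN
  obtain ⟨σ, S, -, h2, h3, h4, h5⟩ := A.exists_phases μ hl hn hnh hδ (c := c) (by linarith)
    (by linarith) B hB (2 * M + 1)
  obtain ⟨D, hD⟩ := exists_run_optCost h3
  have hM : M < optCost B σ := by
    have := h4 D _ hD
    omega
  refine ⟨σ, h2, hM, ?_⟩
  have hpos : (0 : ℝ) < optCost B σ := by exact_mod_cast (by omega : 0 < optCost B σ)
  rw [le_div_iff₀ hpos]
  rcases le_total c 0 with hc | hc
  · exact (mul_nonpos_of_nonpos_of_nonneg hc hpos.le).trans (A.expectedCost_nonneg μ σ)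
  · refine le_trans (mul_le_mul_of_nonneg_left ?_ hc) h5
    exact_mod_cast optCost_le_of_run h3
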